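/- Let $h_1,h_2\colon\mathbb{C}\to\mathbb{C}$ be entire functions that are non-constant and non-linear (that is, not of the form $z\mapsto az+b$), and suppose that they are topologically conjugate via a homeomorphism $\psi\colon\mathbb{C}\to\mathbb{C}$, i.e. $\psi\circ h_1=h_2\circ\psi$. Let $x_1$ be a repelling fixed point of $h_1$, i.e. $h_1(x_1)=x_1$ and $|h_1'(x_1)|>1$, and set $x_2:=\psi(x_1)$. Then $x_2$ is a repelling fixed point of $h_2$. For $j=1,2$ let $f_j\colon\mathbb{C}\to\mathbb{C}$ be the Poincaré function of $h_j$ at $x_j$, i.e. the entire function with $f_j(0)=x_j$, $f_j'(0)=1$ and $f_j(\lambda_j z)=h_j(f_j(z))$ for all $z\in\mathbb{C}$, where $\lambda_j=h_j'(x_j)$. Then there is a homeomorphism $\varphi\colon\mathbb{C}\to\mathbb{C}$ such that $\psi\circ f_1=f_2\circ\varphi$, and if $\psi$ is quasiconformal, then $\varphi$ is also quasiconformal. Here a homeomorphism $\varphi$ of $\mathbb{C}$ is quasiconformal if it belongs to $W^{1,2}_{\mathrm{loc}}(\mathbb{C})$ and there is $k<1$ with $|\partial_{\bar z}\varphi|\le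 k\,|\partial_z\varphi|$ almost everywhere. -/

import Mathlib

open MeasureTheory
open scoped ContDiff

/-- `h` is an affine (possibly constant) map `z ↦ a z + b`. -/
def IsAffineMap (h : ℂ → ℂ) : Prop :=
  ∃ a b : ℂ, ∀ z, h z = a * z + b

/-- `ζ` is a repelling fixed point of `h`: it is fixed and its multiplier `h'(ζ)` has modulus
greater than one. -/
def IsRepellingFixedPoint (h : ℂ → ℂ) (ζ : ℂ) : Prop :=
  h ζ = ζ ∧ 1 < ‖deriv h ζ‖

/-- `f` is the Poincaré function (entire linearizer) of `h` at the repelling fixed point `ζ`: the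
entire function with `f 0 = ζ`, `f'(0) = 1` and `f (λ z) = h (f z)`, where `λ = h'(ζ)`. -/
def IsPoincareFunction (h : ℂ → ℂ) (ζ : ℂ) (f : ℂ → ℂ) : Prop :=
  Differentiable ℂ f ∧ f 0 = ζ ∧ deriv f 0 = 1 ∧ ∀ z, f (deriv h ζ * z) = h (f z)

/-- `g` is the weak derivative of `φ` in the (real) direction `v`, tested against smooth
compactly supported real functions on the plane. -/
def IsWeakDirDeriv (φ : ℂ → ℂ) (v : ℂ) (g : ℂ → ℂ) : Prop :=
  ∀ χ : ℂ → ℝ, ContDiff ℝ ∞ χ → HasCompactSupport χ →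
    ∫ z, (fderiv ℝ χ z v) • φ z = -∫ z, χ z • g z

/-- `g` is locally square-integrable on the plane. -/
def IsLocallyL2 (g : ℂ → ℂ) : Prop :=
  ∀ K : Set ℂ, IsCompact K → MemLp g 2 (volume.restrict K)

/-- Quasiconformality of a homeomorphism of the plane (analytic definition): `φ` has locally
square-integrable weak partial derivatives `φ_x`, `φ_y`, and, for some `k < 1`, the Beltrami
inequality `|∂̄φ| ≤ k |∂φ|` holds almost everywhere, where
`∂φ = (φ_x - i φ_y) / 2` and `∂̄φ = (φ_x + i φ_y) / 2`. -/
def IsQuasiconformal (φ : ℂ ≃ₜ ℂ) : Prop :=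
  ∃ φx φy : ℂ → ℂ,
    IsLocallyL2 φx ∧ IsLocallyL2 φy ∧
    IsWeakDirDeriv φ 1 φx ∧ IsWeakDirDeriv φ Complex.I φy ∧
    ∃ k : ℝ, 0 ≤ k ∧ k < 1 ∧
      ∀ᵐ z : ℂ, ‖(φx z + Complex.I * φy z) / 2‖ ≤ k * ‖(φx z - Complex.I * φy z) / 2‖

/-! Write `a`, `d` for the multipliers at `x₁` and `ψ x₁`. Near `0` the map `f₂` is invertible, so
`p = f₂⁻¹ ∘ ψ ∘ f₁` is defined there, and the functional equations of `f₁`, `f₂` give `p (a z) = d p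
z`. Since `|a| > 1`, setting `φ z = d ^ n * p (z / a ^ n)` for large `n` extends `p` to the plane,
and identities valid near `0` spread by the same scaling. The lift of `ψ⁻¹` built in this way
inverts `φ`, which is therefore a homeomorphism (`exists_homeomorph_lift_poincareFunction`). This
uses `|d| > 1`, which is `IsRepellingFixedPoint.of_conj`: a local inverse of `h₁` contracts to `x₁`,
its conjugate under `ψ` is a holomorphic inverse branch of `h₂`, and its iterates converge uniformly
to the fixed point, so Cauchy's estimate forces its multiplier into the unit disc.

For quasiconformality, on each disc `φ = F ∘ ψ ∘ f` with `F = d ^ N * f₂⁻¹` and `f z = f₁ (z / a ^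
N)`, both conformal where used. Such compositions keep the `L²` weak derivatives
(`isWeakDirDerivOn_comp`, by mollifying `ψ`) and the constant `k`, since `∂` and `∂̄` are multiplied
by factors of equal modulus. The derivatives found on discs glue together
(`IsQuasiconformal.of_eq_comp`). -/

/-! ### Mollification -/

open Filter Topology in
/-- Convolution with a normed bump function does not increase the `L¹` norm. -/
theorem ContDiffBump.integral_norm_convolution_le (b : ContDiffBump (0 : ℂ)) {u : ℂ → ℂ}
    (hu : Integrable u) :
    ∫ z, ‖convolution (b.normed volume) u (ContinuousLinearMap.lsmul ℝ ℝ) volume z‖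
      ≤ ∫ z, ‖u z‖ := by
  have hb : Integrable (b.normed (volume : Measure ℂ)) := b.integrable_normed
  have hI := integral_convolution (μ := (volume : Measure ℂ)) (ν := volume)
    (ContinuousLinearMap.lsmul ℝ ℝ (E := ℝ)) hb hu.norm
  rw [b.integral_normed] at hI
  simp only [ContinuousLinearMap.lsmul_apply, one_smul] at hI
  rw [← hI]
  refine integral_mono (hb.integrable_convolution _ hu).norm
    (hb.integrable_convolution _ hu.norm) fun z ↦ ?_
  simp only [convolution_def]
  refine (norm_integral_le_integral_norm _).trans (le_of_eq ?_)
  refine integral_congr_ae (Eventually.of_forall fun t ↦ ?_)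
  simp [abs_of_nonneg (b.nonneg_normed t)]

open Filter Topology in
/-- Mollifications of a continuous function converge uniformly on compact sets. -/
theorem ContDiffBump.tendstoUniformlyOn_convolution {b : ℕ → ContDiffBump (0 : ℂ)}
    (hb : Tendsto (fun n ↦ (b n).rOut) atTop (𝓝 0)) {u : ℂ → ℂ} (hu : Continuous u)
    {K : Set ℂ} (hK : IsCompact K) :
    TendstoUniformlyOn
      (fun n ↦ convolution ((b n).normed volume) u (ContinuousLinearMap.lsmul ℝ ℝ) volume)
      u atTop K := by
  rw [Metric.tendstoUniformlyOn_iff]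
  intro ε hε
  obtain ⟨δ, hδ, hδu⟩ : ∃ δ > 0, ∀ x ∈ K, ∀ y, dist y x < δ → dist (u y) (u x) < ε / 2 := by
    have := Metric.uniformContinuousOn_iff.1
      ((hK.cthickening (r := 1)).uniformContinuousOn_of_continuous hu.continuousOn) (ε / 2)
      (by positivity)
    obtain ⟨δ, hδ, h⟩ := this
    refine ⟨min δ 1, by positivity, fun x hx y hxy ↦ h y ?_ x ?_ (hxy.trans_le (min_le_left _ _))⟩
    · exact Metric.mem_cthickening_of_dist_le y x 1 K hx (hxy.le.trans (min_le_right _ _))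
    · exact Metric.self_subset_cthickening K hx
  filter_upwards [hb.eventually (gt_mem_nhds hδ)] with n hn x hx
  rw [dist_comm]
  refine lt_of_le_of_lt ((b n).dist_normed_convolution_le hu.aestronglyMeasurable
    (ε := ε / 2) fun y hy ↦ ?_) (by linarith)
  exact (hδu x hx y ((Metric.mem_ball.1 hy).trans hn)).le

open Filter Topology in
/-- Mollifications of an integrable function converge in `L¹` on compact sets. -/
theorem ContDiffBump.tendsto_setIntegral_norm_convolution_sub {b : ℕ → ContDiffBump (0 : ℂ)}
    (hb : Tendsto (fun n ↦ (b n).rOut) atTop (𝓝 0)) {u : ℂ → ℂ} (hu : Integrable u)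
    {K : Set ℂ} (hK : IsCompact K) :
    Tendsto (fun n ↦ ∫ z in K,
      ‖convolution ((b n).normed volume) u (ContinuousLinearMap.lsmul ℝ ℝ) volume z - u z‖)
      atTop (𝓝 0) := by
  rw [Metric.tendsto_atTop']
  intro ε hε
  -- A continuous compactly supported `w` close to `u` splits the error into three parts of at most
  -- `ε / 4` each. The `m + 1` below guards against `K` having measure zero.
  obtain ⟨w, hwc, hwu, hw, hwi⟩ :=
    hu.exists_hasCompactSupport_integral_sub_le (ε := ε / 4) (by positivity)
  set m := volume.real K with hm
  have hm0 : 0 ≤ m := measureReal_nonneg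
  have hunif := Metric.tendstoUniformlyOn_iff.1
    (ContDiffBump.tendstoUniformlyOn_convolution hb hw hK) (ε / (4 * (m + 1))) (by positivity)
  obtain ⟨N, hN⟩ := eventually_atTop.1 hunif
  refine ⟨N, fun n hn ↦ ?_⟩
  have hbi : Integrable ((b n).normed (volume : Measure ℂ)) := (b n).integrable_normed
  set C : (ℂ → ℂ) → ℂ → ℂ := fun u ↦
    convolution ((b n).normed volume) u (ContinuousLinearMap.lsmul ℝ ℝ) volume with hC
  have hCi : ∀ {v : ℂ → ℂ}, Integrable v → Integrable (C v) := fun hv ↦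
    hbi.integrable_convolution _ hv
  have hlocal : ∀ {v : ℂ → ℂ}, Integrable v → ConvolutionExists ((b n).normed volume) v
      (ContinuousLinearMap.lsmul ℝ ℝ) volume := fun hv ↦
    (b n).hasCompactSupport_normed.convolutionExists_left _ (b n).continuous_normed
      hv.locallyIntegrable
  have hsub : ∀ z, C u z = C (u - w) z + C w z := fun z ↦ by
    have := (hlocal (hu.sub hwi)).distrib_add (hlocal hwi)
    rw [sub_add_cancel] at this
    exact congrFun this z
  rw [Real.dist_eq, sub_zero, abs_of_nonneg (integral_nonneg fun _ ↦ norm_nonneg _)]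
  have h1 : ∫ z in K, ‖C (u - w) z‖ ≤ ε / 4 :=
    (setIntegral_le_integral (hCi (hu.sub hwi)).norm
      (Eventually.of_forall fun _ ↦ norm_nonneg _)).trans
      (((b n).integral_norm_convolution_le (hu.sub hwi)).trans hwu)
  have h2 : ∫ z in K, ‖C w z - w z‖ ≤ ε / 4 := by
    have h := norm_setIntegral_le_of_norm_le_const (μ := volume) (s := K)
      (f := fun z ↦ ‖C w z - w z‖) (C := ε / (4 * (m + 1))) hK.measure_lt_top fun z hz ↦ by
        rw [norm_norm, ← dist_eq_norm, dist_comm]; exact (hN n hn.le z hz).le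
    refine (le_abs_self _).trans (h.trans ?_)
    rw [div_mul_eq_mul_div, div_le_div_iff₀ (by positivity) (by positivity)]
    change ε * m * 4 ≤ _
    nlinarith
  have h3 : ∫ z in K, ‖u z - w z‖ ≤ ε / 4 :=
    (setIntegral_le_integral (hu.sub hwi).norm
      (Eventually.of_forall fun _ ↦ norm_nonneg _)).trans hwu
  have hi1 : IntegrableOn (fun z ↦ ‖C (u - w) z‖) K := (hCi (hu.sub hwi)).norm.integrableOn
  have hi2 : IntegrableOn (fun z ↦ ‖C w z - w z‖) K := ((hCi hwi).sub hwi).norm.integrableOn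
  have hi3 : IntegrableOn (fun z ↦ ‖u z - w z‖) K := (hu.sub hwi).norm.integrableOn
  have h4 : ∫ z in K, ‖C u z - u z‖
      ≤ ∫ z in K, (‖C (u - w) z‖ + ‖C w z - w z‖ + ‖u z - w z‖) := by
    refine integral_mono ((hCi hu).sub hu).norm.integrableOn ((hi1.add hi2).add hi3) fun z ↦ ?_
    have : C u z - u z = C (u - w) z + (C w z - w z) - (u z - w z) := by rw [hsub]; ring
    simp only [this]
    exact (norm_sub_le _ _).trans (add_le_add_left (norm_add_le _ _) _)
  have h5 : ∫ z in K, (‖C (u - w) z‖ + ‖C w z - w z‖ + ‖u z - w z‖) =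
      (∫ z in K, ‖C (u - w) z‖) + (∫ z in K, ‖C w z - w z‖) + ∫ z in K, ‖u z - w z‖ := by
    rw [← integral_add hi1 hi2]
    exact integral_add (hi1.add hi2) hi3
  change ∫ z in K, ‖C u z - u z‖ < ε
  linarith

open Filter Topology in
/-- Mollifications of a locally integrable function converge in `L¹` on compact sets. -/
theorem ContDiffBump.tendsto_setLIntegral_enorm_convolution_sub {b : ℕ → ContDiffBump (0 : ℂ)}
    (hb : Tendsto (fun n ↦ (b n).rOut) atTop (𝓝 0)) {g : ℂ → ℂ} (hg : LocallyIntegrable g)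
    {K : Set ℂ} (hK : IsCompact K) :
    Tendsto (fun n ↦ ∫⁻ z in K,
      ‖convolution ((b n).normed volume) g (ContinuousLinearMap.lsmul ℝ ℝ) volume z - g z‖ₑ)
      atTop (𝓝 0) := by
  -- Once the kernel has radius less than `1`, mollification on `K` sees only the values on `K'`, so
  -- `g` may be cut off outside `K'`.
  set K' := Metric.cthickening 1 K
  have hK' : IsCompact K' := hK.cthickening
  set u := K'.indicator g with hu_def
  have hu : Integrable u :=
    (integrable_indicator_iff hK'.measurableSet).2 (hg.integrableOn_isCompact hK')
  have key := ContDiffBump.tendsto_setIntegral_norm_convolution_sub hb hu hK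
  have key' := ENNReal.tendsto_ofReal key
  rw [ENNReal.ofReal_zero] at key'
  refine key'.congr' ?_
  filter_upwards [hb.eventually (gt_mem_nhds one_pos)] with n hn
  have hbi : Integrable ((b n).normed (volume : Measure ℂ)) := (b n).integrable_normed
  refine (ofReal_integral_norm_eq_lintegral_enorm
    (((hbi.integrable_convolution _ hu).sub hu).integrableOn)).trans ?_
  refine setLIntegral_congr_fun hK.measurableSet fun z hz ↦ ?_
  have huz : u z = g z := Set.indicator_of_mem (Metric.self_subset_cthickening K hz) g
  have hcz : convolution ((b n).normed volume) u (ContinuousLinearMap.lsmul ℝ ℝ) volume z =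
      convolution ((b n).normed volume) g (ContinuousLinearMap.lsmul ℝ ℝ) volume z := by
    simp only [convolution_def]
    refine integral_congr_ae (Eventually.of_forall fun t ↦ ?_)
    simp only [ContinuousLinearMap.lsmul_apply]
    by_cases ht : t ∈ Function.support ((b n).normed (volume : Measure ℂ))
    · rw [(b n).support_normed_eq, Metric.mem_ball, dist_zero_right] at ht
      have : z - t ∈ K' := Metric.mem_cthickening_of_dist_le _ z 1 K hz (by
        simpa [dist_eq_norm] using (ht.trans hn).le)
      rw [hu_def, Set.indicator_of_mem this]
    · rw [Function.notMem_support.1 ht]; simp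
  change ‖_ - u z‖ₑ = _
  rw [huz, hcz]

/-- The directional derivative of a mollification is the mollification of the weak derivative. -/
theorem IsWeakDirDeriv.fderiv_convolution {u g : ℂ → ℂ} {v : ℂ} (h : IsWeakDirDeriv u v g)
    (hu : Continuous u) (b : ContDiffBump (0 : ℂ)) (z : ℂ) :
    fderiv ℝ (convolution (b.normed volume) u (ContinuousLinearMap.lsmul ℝ ℝ) volume) z v =
      convolution (b.normed volume) g (ContinuousLinearMap.lsmul ℝ ℝ) volume z := by
  have hbc : HasCompactSupport (b.normed (volume : Measure ℂ)) := b.hasCompactSupport_normed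
  have hbd : ContDiff ℝ ∞ (b.normed (volume : Measure ℂ)) := b.contDiff_normed
  have hul : LocallyIntegrable u := hu.locallyIntegrable
  rw [(hbc.hasFDerivAt_convolution_left (ContinuousLinearMap.lsmul ℝ ℝ)
    (b.contDiff_normed (n := 1)) hul z).fderiv]
  -- The reflected kernel `t ↦ b (z - t)` serves as test function; the sign from the reflection
  -- cancels the one in the weak derivative.
  have h1 : ContDiff ℝ ∞ fun t ↦ b.normed (volume : Measure ℂ) (z - t) :=
    hbd.comp (contDiff_const.sub contDiff_id)
  have h2 : HasCompactSupport fun t ↦ b.normed (volume : Measure ℂ) (z - t) :=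
    hbc.comp_homeomorph (Homeomorph.subLeft z)
  have key := h _ h1 h2
  rw [convolution_eq_swap, convolution_eq_swap, ContinuousLinearMap.integral_apply]
  · simp only [ContinuousLinearMap.precompL_apply, ContinuousLinearMap.lsmul_apply]
    rw [← neg_eq_iff_eq_neg] at key
    rw [← key, ← integral_neg]
    refine integral_congr_ae (Filter.Eventually.of_forall fun t ↦ ?_)
    have hd : HasFDerivAt (fun t ↦ b.normed (volume : Measure ℂ) (z - t))
        ((fderiv ℝ (b.normed (volume : Measure ℂ)) (z - t)).comp (-ContinuousLinearMap.id ℝ ℂ))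
        t :=
      ((hbd.differentiable (by simp)) (z - t)).hasFDerivAt.comp t
        ((hasFDerivAt_id t).const_sub z)
    simp only [hd.fderiv]
    simp
  · have hc : HasCompactSupport (fderiv ℝ (b.normed (volume : Measure ℂ))) := hbc.fderiv ℝ
    exact (convolutionExistsAt_iff_integrable_swap).1
      (hc.convolutionExists_left _ (hbd.continuous_fderiv (by simp)) hul z)

theorem IsLocallyL2.locallyIntegrable {g : ℂ → ℂ} (hg : IsLocallyL2 g) : LocallyIntegrable g := by
  rw [locallyIntegrable_iff]
  intro K hK
  have : IsFiniteMeasure (volume.restrict K) := ⟨by simpa using hK.measure_lt_top⟩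
  exact (hg K hK).integrable one_le_two

/-! ### Weak derivatives under holomorphic composition -/

/-- The weak derivative of `φ` in the direction `v` on the open set `U` is `g`. -/
def IsWeakDirDerivOn (U : Set ℂ) (φ : ℂ → ℂ) (v : ℂ) (g : ℂ → ℂ) : Prop :=
  ∀ χ : ℂ → ℝ, ContDiff ℝ ∞ χ → HasCompactSupport χ → tsupport χ ⊆ U →
    ∫ z, (fderiv ℝ χ z v) • φ z = -∫ z, χ z • g z

/-- An injective holomorphic map without critical points pushes the area measure of a compact set
forward to a measure dominated by a multiple of the area. -/
theorem exists_map_restrict_volume_le {f : ℂ → ℂ} (hf : Differentiable ℂ f)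
    {K : Set ℂ} (hK : IsCompact K) (hinj : Set.InjOn f K) (hd : ∀ z ∈ K, deriv f z ≠ 0) :
    ∃ C : ENNReal, C ≠ ⊤ ∧
      (volume.restrict K).map f ≤ C • volume.restrict (f '' K) := by
  -- The real Jacobian of `f` is `|f'|²`, bounded below by `c²` on `K`; hence the constant `c⁻²`.
  obtain ⟨c, hc, hcK⟩ : ∃ c > 0, ∀ z ∈ K, c ≤ ‖deriv f z‖ := by
    rcases K.eq_empty_or_nonempty with rfl | hne
    · exact ⟨1, one_pos, by simp⟩
    · obtain ⟨z₀, hz₀, hmin⟩ := hK.exists_isMinOn hne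
        (f := fun z ↦ ‖deriv f z‖) (hf.contDiff (n := 1)).continuous_deriv_one.norm.continuousOn
      exact ⟨‖deriv f z₀‖, norm_pos_iff.2 (hd z₀ hz₀), fun z hz ↦ hmin hz⟩
  have hc2 : ENNReal.ofReal (c ^ 2) ≠ 0 := by simpa using hc.ne'
  refine ⟨(ENNReal.ofReal (c ^ 2))⁻¹, ENNReal.inv_ne_top.2 hc2, ?_⟩
  refine Measure.le_iff.2 fun A hA ↦ ?_
  have hfm : Measurable f := hf.continuous.measurable
  rw [Measure.map_apply hfm hA, Measure.restrict_apply (hfm hA), Measure.smul_apply, smul_eq_mul]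
  set s := f ⁻¹' A ∩ K
  have hs : MeasurableSet s := (hfm hA).inter hK.measurableSet
  have himage := lintegral_abs_det_fderiv_eq_addHaar_image volume hs
    (f' := fun z ↦ (fderiv ℂ f z).restrictScalars ℝ)
    (fun z _ ↦ ((hf z).hasFDerivAt.restrictScalars ℝ).hasFDerivWithinAt)
    (hinj.mono Set.inter_subset_right)
  have hdet : ∀ z, |((fderiv ℂ f z).restrictScalars ℝ).det| = ‖deriv f z‖ ^ 2 := fun z ↦ by
    have h1 : fderiv ℂ f z = ContinuousLinearMap.toSpanSingleton ℂ (deriv f z) := by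
      ext; simp
    rw [h1]
    simp [ContinuousLinearMap.det, LinearMap.det_restrictScalars, Algebra.norm_complex_apply,
      Complex.normSq_eq_norm_sq]
  have hle : ENNReal.ofReal (c ^ 2) * volume s ≤ volume (f '' s) := by
    rw [← himage, ← setLIntegral_const]
    refine setLIntegral_mono' hs fun z hz ↦ ENNReal.ofReal_le_ofReal ?_
    rw [hdet]
    have := hcK z hz.2
    gcongr
  have hsub : volume (f '' s) ≤ volume.restrict (f '' K) A := by
    rw [Measure.restrict_apply hA]
    refine measure_mono ?_
    rintro _ ⟨z, hz, rfl⟩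
    exact ⟨hz.1, z, hz.2, rfl⟩
  rw [mul_comm, ← div_eq_mul_inv, ENNReal.le_div_iff_mul_le (Or.inl hc2)
    (Or.inl ENNReal.ofReal_ne_top), mul_comm]
  exact hle.trans hsub

-- Split `a n * b n = a n * B + a n * (b n - B)`: dominated convergence handles the first term, and
-- the uniform bound on `a n` with `L¹` convergence of `b n` kills the second.
open Filter Topology in
theorem tendsto_integral_mul_of_tendsto_lintegral {α : Type*} [MeasurableSpace α] {μ : Measure α}
    {a b : ℕ → α → ℂ} {A B : α → ℂ} {M : ℝ}
    (ha : ∀ᶠ n in atTop, AEStronglyMeasurable (a n) μ)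
    (hM : ∀ᶠ n in atTop, ∀ᵐ z ∂μ, ‖a n z‖ ≤ M)
    (hA : ∀ᵐ z ∂μ, Tendsto (fun n ↦ a n z) atTop (𝓝 (A z)))
    (hb : ∀ᶠ n in atTop, Integrable (b n) μ) (hB : Integrable B μ)
    (hbB : Tendsto (fun n ↦ ∫⁻ z, ‖b n z - B z‖ₑ ∂μ) atTop (𝓝 0)) :
    Tendsto (fun n ↦ ∫ z, a n z * b n z ∂μ) atTop (𝓝 (∫ z, A z * B z ∂μ)) := by
  have h1 : Tendsto (fun n ↦ ∫ z, a n z * B z ∂μ) atTop (𝓝 (∫ z, A z * B z ∂μ)) := by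
    refine tendsto_integral_filter_of_dominated_convergence (fun z ↦ M * ‖B z‖) ?_ ?_
      (hB.norm.const_mul M) ?_
    · filter_upwards [ha] with n hn using hn.mul hB.aestronglyMeasurable
    · filter_upwards [hM] with n hn
      filter_upwards [hn] with z hz
      rw [norm_mul]
      gcongr
    · filter_upwards [hA] with z hz using hz.mul_const _
  have h2 : Tendsto (fun n ↦ ∫ z, a n z * (b n z - B z) ∂μ) atTop (𝓝 0) := by
    have hr : Tendsto (fun n ↦ M * (∫⁻ z, ‖b n z - B z‖ₑ ∂μ).toReal) atTop (𝓝 0) := by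
      simpa using ((ENNReal.tendsto_toReal ENNReal.zero_ne_top).comp hbB).const_mul M
    refine squeeze_zero_norm' ?_ hr
    filter_upwards [hM, hb] with n hn hbn
    have hi : Integrable (fun z ↦ b n z - B z) μ := hbn.sub hB
    rw [← ofReal_integral_norm_eq_lintegral_enorm hi,
      ENNReal.toReal_ofReal (integral_nonneg fun _ ↦ norm_nonneg _), ← integral_const_mul]
    refine norm_integral_le_of_norm_le (hi.norm.const_mul M) ?_
    filter_upwards [hn] with z hz
    rw [norm_mul]
    gcongr
  have h3 := h1.add h2
  rw [add_zero] at h3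
  refine h3.congr' ?_
  filter_upwards [hM, hb, ha] with n hn hbn han
  have hi : Integrable (fun z ↦ b n z - B z) μ := hbn.sub hB
  rw [← integral_add (hB.bdd_mul han hn) (hi.bdd_mul han hn)]
  refine integral_congr_ae (Eventually.of_forall fun z ↦ ?_)
  ring

/-- The expected weak derivative of `F ∘ ψ ∘ f` in the direction `v`, where `F` and `f` are
holomorphic and `px`, `py` are the weak partial derivatives of `ψ`. -/
noncomputable def chainDirDeriv (F ψ f px py : ℂ → ℂ) (v z : ℂ) : ℂ :=
  deriv F (ψ (f z)) *
    ((deriv f z * v).re • px (f z) + (deriv f z * v).im • py (f z))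

theorem MemLp.comp_of_map_restrict_le {f g : ℂ → ℂ} (hf : Continuous f) {p : ENNReal} {K : Set ℂ}
    {C : ENNReal} (hC : C ≠ ⊤)
    (hle : (volume.restrict K).map f ≤ C • volume.restrict (f '' K))
    (hg : MemLp g p (volume.restrict (f '' K))) :
    MemLp (fun z ↦ g (f z)) p (volume.restrict K) := by
  have h := (hg.smul_measure hC).mono_measure hle
  exact (memLp_map_measure_iff h.1 hf.aemeasurable).1 h

theorem setLIntegral_enorm_comp_le {f g : ℂ → ℂ} (hf : Continuous f) {K : Set ℂ} {C : ENNReal}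
    (hle : (volume.restrict K).map f ≤ C • volume.restrict (f '' K))
    (hg : AEStronglyMeasurable g (volume.restrict (f '' K))) :
    ∫⁻ z in K, ‖g (f z)‖ₑ ≤ C * ∫⁻ z in f '' K, ‖g z‖ₑ := by
  have hg' : AEStronglyMeasurable g ((volume.restrict K).map f) :=
    (hg.smul_measure C).mono_measure hle
  rw [← lintegral_map' (f := fun z ↦ ‖g z‖ₑ) hg'.enorm hf.aemeasurable]
  refine (lintegral_mono' hle le_rfl).trans ?_
  rw [lintegral_smul_measure, smul_eq_mul]

open Filter Topology in
theorem exists_contDiffBump_tendsto_zero :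
    ∃ b : ℕ → ContDiffBump (0 : ℂ), Tendsto (fun n ↦ (b n).rOut) atTop (𝓝 0) := by
  refine ⟨fun n ↦ ⟨1 / (2 * (n + 1)), 1 / (n + 1), by positivity, ?_⟩, ?_⟩
  · apply one_div_lt_one_div_of_lt <;> [positivity; linarith [n.cast_nonneg (α := ℝ)]]
  · exact tendsto_one_div_add_atTop_nhds_zero_nat

/-- The holomorphic factors are bounded on `K`, and `px ∘ f`, `py ∘ f` stay in `L²` because `f`
pushes area on `K` forward to at most a multiple of area. -/
theorem memLp_chainDirDeriv {F ψ f px py : ℂ → ℂ} {U V K : Set ℂ} (hψ : Continuous ψ)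
    (hpx : IsLocallyL2 px) (hpy : IsLocallyL2 py) (hf : Differentiable ℂ f)
    (hinj : Set.InjOn f U) (hd : ∀ z ∈ U, deriv f z ≠ 0) (hV : IsOpen V)
    (hF : DifferentiableOn ℂ F V) (hUV : ∀ z ∈ U, ψ (f z) ∈ V) (hK : IsCompact K) (hKU : K ⊆ U)
    (v : ℂ) :
    MemLp (chainDirDeriv F ψ f px py v) 2 (volume.restrict K) := by
  obtain ⟨C, hC, hle⟩ := exists_map_restrict_volume_le hf hK (hinj.mono hKU)
    fun z hz ↦ hd z (hKU hz)
  have hfc := hf.continuous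
  have hdf : Continuous (deriv f) := (hf.contDiff (n := 1)).continuous_deriv_one
  have hFc : ContinuousOn (fun z ↦ deriv F (ψ (f z))) K :=
    ((hF.deriv hV).continuousOn.comp (hψ.comp hfc).continuousOn
      fun z hz ↦ hUV z (hKU hz))
  have hb : ∀ {a : ℂ → ℂ} {g : ℂ → ℂ}, ContinuousOn a K → MemLp g 2 (volume.restrict K) →
      MemLp (fun z ↦ a z * g z) 2 (volume.restrict K) := fun {a g} ha hg ↦ by
    obtain ⟨M, hM⟩ := hK.exists_bound_of_continuousOn ha
    refine (hg.const_mul (M : ℂ)).mono ((ha.aestronglyMeasurable hK.measurableSet).mul hg.1) ?_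
    refine ae_restrict_of_forall_mem hK.measurableSet fun z hz ↦ ?_
    rw [norm_mul, norm_mul, Complex.norm_real]
    gcongr
    exact (hM z hz).trans (le_abs_self M)
  have hfK : IsCompact (f '' K) := hK.image hfc
  have hre : Continuous fun z ↦ (((deriv f z * v).re : ℝ) : ℂ) := by fun_prop
  have him : Continuous fun z ↦ (((deriv f z * v).im : ℝ) : ℂ) := by fun_prop
  have h1 := hb hre.continuousOn (MemLp.comp_of_map_restrict_le hfc hC hle (hpx _ hfK))
  have h2 := hb him.continuousOn (MemLp.comp_of_map_restrict_le hfc hC hle (hpy _ hfK))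
  exact hb hFc (h1.add h2)

theorem fderiv_comp_comp_apply {F G f : ℂ → ℂ} {z v : ℂ} (hf : DifferentiableAt ℂ f z)
    (hG : DifferentiableAt ℝ G (f z)) (hF : DifferentiableAt ℂ F (G (f z))) :
    DifferentiableAt ℝ (fun w ↦ F (G (f w))) z ∧
      fderiv ℝ (fun w ↦ F (G (f w))) z v =
        deriv F (G (f z)) * ((deriv f z * v).re • fderiv ℝ G (f z) 1 +
          (deriv f z * v).im • fderiv ℝ G (f z) Complex.I) := by
  have h := (hF.hasFDerivAt.restrictScalars ℝ).comp z
    (hG.hasFDerivAt.comp z (hf.hasFDerivAt.restrictScalars ℝ))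
  refine ⟨h.differentiableAt, ?_⟩
  have h' : fderiv ℝ (fun w ↦ F (G (f w))) z v = fderiv ℂ F (G (f z))
      (fderiv ℝ G (f z) (fderiv ℂ f z v)) := by
    rw [show (fun w ↦ F (G (f w))) = F ∘ G ∘ f from rfl, h.fderiv]; rfl
  have hv : fderiv ℂ f z v = deriv f z * v := by
    rw [fderiv_eq_smul_deriv, smul_eq_mul, mul_comm]
  rw [h', hv, fderiv_eq_smul_deriv, smul_eq_mul, mul_comm, ← map_smul, ← map_smul, ← map_add]
  congr 2
  conv_lhs => rw [← Complex.re_add_im (deriv f z * v)]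
  simp

-- The chain rule and integration by parts are classical for `F ∘ ψₙ ∘ f`, with `ψₙ` a mollification
-- of `ψ`. In the limit `ψₙ → ψ` uniformly on `f '' K`, while the partial derivatives of `ψₙ`
-- converge only in `L¹`, which suffices as their coefficients are bounded and converge pointwise.
open Filter Topology in
theorem isWeakDirDerivOn_comp {F ψ f px py : ℂ → ℂ} {U V : Set ℂ} (hψ : Continuous ψ)
    (hpx : IsLocallyL2 px) (hpy : IsLocallyL2 py) (hwx : IsWeakDirDeriv ψ 1 px)
    (hwy : IsWeakDirDeriv ψ Complex.I py) (hf : Differentiable ℂ f)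
    (hinj : Set.InjOn f U) (hd : ∀ z ∈ U, deriv f z ≠ 0) (hV : IsOpen V)
    (hF : DifferentiableOn ℂ F V) (hUV : ∀ z ∈ U, ψ (f z) ∈ V) (v : ℂ) :
    IsWeakDirDerivOn U (fun z ↦ F (ψ (f z))) v (chainDirDeriv F ψ f px py v) := by
  intro χ hχ hχc hχU
  set K := tsupport χ
  have hK : IsCompact K := hχc
  obtain ⟨b, hb⟩ := exists_contDiffBump_tendsto_zero
  set m : (ℂ → ℂ) → ℕ → ℂ → ℂ := fun u n ↦
    convolution ((b n).normed volume) u (ContinuousLinearMap.lsmul ℝ ℝ) volume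
  obtain ⟨C, hC, hle⟩ := exists_map_restrict_volume_le hf hK (hinj.mono hχU)
    fun z hz ↦ hd z (hχU hz)
  have hfc := hf.continuous
  have hdf : Continuous (deriv f) := (hf.contDiff (n := 1)).continuous_deriv_one
  have hfK : IsCompact (f '' K) := hK.image hfc
  have hS : IsCompact (ψ '' (f '' K)) := hfK.image hψ
  have hSV : ψ '' (f '' K) ⊆ V := by
    rintro _ ⟨_, ⟨z, hz, rfl⟩, rfl⟩; exact hUV z (hχU hz)
  -- `T` is a compact neighbourhood of `ψ (f K)` in `V`: it eventually contains the mollified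
  -- values, and `F`, `F'` are bounded on it.
  obtain ⟨δ, hδ, hT⟩ := hS.exists_cthickening_subset_open hV hSV
  set T := Metric.cthickening δ (ψ '' (f '' K))
  have hTc : IsCompact T := hS.cthickening
  have hmd : ∀ n, ContDiff ℝ 1 (m ψ n) := fun n ↦
    (b n).hasCompactSupport_normed.contDiff_convolution_left _ ((b n).contDiff_normed (n := 1))
      hψ.locallyIntegrable
  have hmc : ∀ {g : ℂ → ℂ}, LocallyIntegrable g → ∀ n, Continuous (m g n) := fun hg n ↦
    ((b n).hasCompactSupport_normed.contDiff_convolution_left (n := 0) _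
      ((b n).contDiff_normed (n := 0)) hg).continuous
  have hunif := ContDiffBump.tendstoUniformlyOn_convolution hb hψ hfK
  have hmT : ∀ᶠ n in atTop, ∀ z ∈ K, m ψ n (f z) ∈ T := by
    filter_upwards [Metric.tendstoUniformlyOn_iff.1 hunif δ hδ] with n hn z hz
    refine Metric.mem_cthickening_of_dist_le _ (ψ (f z)) δ _ ⟨f z, ⟨z, hz, rfl⟩, rfl⟩ ?_
    rw [dist_comm]
    exact (hn (f z) ⟨z, hz, rfl⟩).le
  have hFc : ContinuousOn F V := hF.continuousOn
  have hF'c : ContinuousOn (deriv F) V := (hF.deriv hV).continuousOn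
  obtain ⟨M, hM⟩ := hTc.exists_bound_of_continuousOn (hFc.mono hT)
  obtain ⟨M', hM'⟩ := hTc.exists_bound_of_continuousOn (hF'c.mono hT)
  have hχ0 : ∀ z, z ∉ K → χ z = 0 := fun z hz ↦ image_eq_zero_of_notMem_tsupport hz
  have hχ'0 : ∀ z, z ∉ K → fderiv ℝ χ z v = 0 := fun z hz ↦ by
    rw [image_eq_zero_of_notMem_tsupport (f := fderiv ℝ χ)
      (fun h ↦ hz (tsupport_fderiv_subset ℝ h))]; rfl
  have hχ'c : Continuous fun z ↦ fderiv ℝ χ z v :=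
    (hχ.continuous_fderiv (by simp)).clm_apply continuous_const
  have hptw : ∀ z ∈ K, Tendsto (fun n ↦ m ψ n (f z)) atTop (𝓝 (ψ (f z))) := fun z hz ↦
    hunif.tendsto_at ⟨z, hz, rfl⟩
  have hnV : ∀ z ∈ K, V ∈ 𝓝 (ψ (f z)) := fun z hz ↦ hV.mem_nhds (hUV z (hχU hz))
  have hcomp : ∀ {A : ℂ → ℂ} {n : ℕ}, ContinuousOn A V → (∀ z ∈ K, m ψ n (f z) ∈ T) →
      ContinuousOn (fun z ↦ A (m ψ n (f z))) K := fun {A n} hA hn ↦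
    hA.comp ((hmd n).continuous.comp hfc).continuousOn fun z hz ↦ hT (hn z hz)
  have hIK : ∀ {A : ℂ → ℂ}, ContinuousOn A K → (∀ z, z ∉ K → A z = 0) → Integrable A :=
    fun hA h0 ↦ (integrableOn_iff_integrable_of_support_subset
      (fun z hz ↦ by_contra fun h ↦ hz (h0 z h))).1 (hA.integrableOn_compact hK)
  -- the mollified direction derivative
  set B : ℕ → ℂ → ℂ := fun n z ↦
    (deriv f z * v).re • m px n (f z) + (deriv f z * v).im • m py n (f z)
  set B₀ : ℂ → ℂ := fun z ↦ (deriv f z * v).re • px (f z) + (deriv f z * v).im • py (f z)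
  have hBc : ∀ n, Continuous (B n) := fun n ↦ by
    have h1 := (hmc hpx.locallyIntegrable n).comp hfc
    have h2 := (hmc hpy.locallyIntegrable n).comp hfc
    have hv : Continuous fun z ↦ deriv f z * v := hdf.mul continuous_const
    exact ((Complex.continuous_re.comp hv).smul h1).add ((Complex.continuous_im.comp hv).smul h2)
  have hderiv : ∀ {n : ℕ} {z : ℂ}, m ψ n (f z) ∈ T →
      DifferentiableAt ℝ (fun w ↦ F (m ψ n (f w))) z ∧
      fderiv ℝ (fun w ↦ F (m ψ n (f w))) z v = deriv F (m ψ n (f z)) * B n z :=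
    fun {n z} hz ↦ by
      have h := fderiv_comp_comp_apply (v := v) (hf z)
        ((hmd n).differentiable one_ne_zero (f z))
        (hF.differentiableAt (hV.mem_nhds (hT hz)))
      refine ⟨h.1, h.2.trans ?_⟩
      rw [hwx.fderiv_convolution hψ, hwy.fderiv_convolution hψ]
  have hparts : ∀ᶠ n in atTop, ∫ z in K, (fderiv ℝ χ z v) • F (m ψ n (f z)) =
      -∫ z in K, (χ z • deriv F (m ψ n (f z))) * B n z := by
    filter_upwards [hmT] with n hn
    have hK2 : ∀ z, z ∈ K → χ z • fderiv ℝ (fun w ↦ F (m ψ n (f w))) z v =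
        (χ z • deriv F (m ψ n (f z))) * B n z := fun z hz ↦ by
      rw [(hderiv (hn z hz)).2, smul_mul_assoc]
    have hcont : ContinuousOn (fun z ↦ (χ z • deriv F (m ψ n (f z))) * B n z) K :=
      (hχ.continuous.continuousOn.smul (hcomp hF'c hn)).mul (hBc n).continuousOn
    have key := integral_smul_fderiv_eq_neg_fderiv_smul_of_integrable (μ := volume)
      (f := χ) (g := fun w ↦ F (m ψ n (f w))) (v := v)
      (hIK (hχ'c.continuousOn.smul (hcomp hFc hn)) fun z hz ↦ by simp [hχ'0 z hz])
      (hIK (hcont.congr hK2) fun z hz ↦ by simp [hχ0 z hz])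
      (hIK (hχ.continuous.continuousOn.smul (hcomp hFc hn)) fun z hz ↦ by simp [hχ0 z hz])
      (fun z _ ↦ hχ.differentiable (by simp) z)
      (fun z hz ↦ (hderiv (hn z hz)).1)
    rw [← setIntegral_congr_fun hK.measurableSet hK2,
      setIntegral_eq_integral_of_forall_compl_eq_zero (fun z hz ↦ by simp [hχ'0 z hz]),
      setIntegral_eq_integral_of_forall_compl_eq_zero (fun z hz ↦ by simp [hχ0 z hz]), key, neg_neg]
  have hlim1 : Tendsto (fun n ↦ ∫ z in K, (fderiv ℝ χ z v) • F (m ψ n (f z))) atTop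
      (𝓝 (∫ z in K, (fderiv ℝ χ z v) • F (ψ (f z)))) := by
    refine tendsto_integral_filter_of_dominated_convergence (fun z ↦ ‖fderiv ℝ χ z v‖ * M)
      ?_ ?_ ?_ ?_
    · filter_upwards [hmT] with n hn
      exact (hχ'c.continuousOn.smul (hcomp hFc hn)).aestronglyMeasurable hK.measurableSet
    · filter_upwards [hmT] with n hn
      refine ae_restrict_of_forall_mem hK.measurableSet fun z hz ↦ ?_
      rw [norm_smul]
      gcongr
      exact hM _ (hn z hz)
    · exact ((hχ'c.norm.mul continuous_const).continuousOn).integrableOn_compact hK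
    · refine ae_restrict_of_forall_mem hK.measurableSet fun z hz ↦ ?_
      exact (((hFc.continuousAt (hnV z hz)).tendsto).comp (hptw z hz)).const_smul _
  have hpart : ∀ {g : ℂ → ℂ}, IsLocallyL2 g →
      Tendsto (fun n ↦ ∫⁻ z in K, ‖m g n (f z) - g (f z)‖ₑ) atTop (𝓝 0) := fun {g} hg ↦ by
    have h1 := ContDiffBump.tendsto_setLIntegral_enorm_convolution_sub hb hg.locallyIntegrable hfK
    have h2 := ENNReal.Tendsto.const_mul h1 (Or.inr hC)
    rw [mul_zero] at h2
    refine tendsto_of_tendsto_of_tendsto_of_le_of_le tendsto_const_nhds h2 (fun _ ↦ zero_le)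
      fun n ↦ ?_
    exact setLIntegral_enorm_comp_le (g := fun w ↦ m g n w - g w) hfc hle
      ((hmc hg.locallyIntegrable n).aestronglyMeasurable.sub (hg _ hfK).1)
  obtain ⟨R, hR⟩ := hK.exists_bound_of_continuousOn (f := fun z ↦ deriv f z * v)
    (hdf.mul continuous_const).continuousOn
  have hmeas : ∀ {g : ℂ → ℂ}, IsLocallyL2 g → ∀ n,
      AEStronglyMeasurable (fun z ↦ m g n (f z) - g (f z)) (volume.restrict K) := fun {g} hg n ↦
    ((hmc hg.locallyIntegrable n).comp hfc).aestronglyMeasurable.sub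
      (MemLp.comp_of_map_restrict_le hfc hC hle (hg _ hfK)).1
  have hBL1 : Tendsto (fun n ↦ ∫⁻ z in K, ‖B n z - B₀ z‖ₑ) atTop (𝓝 0) := by
    have h2 := ENNReal.Tendsto.const_mul (a := ENNReal.ofReal R) ((hpart hpx).add (hpart hpy))
      (Or.inr ENNReal.ofReal_ne_top)
    rw [add_zero, mul_zero] at h2
    refine tendsto_of_tendsto_of_tendsto_of_le_of_le tendsto_const_nhds h2 (fun _ ↦ zero_le)
      fun n ↦ ?_
    dsimp only
    rw [← lintegral_add_left' (hmeas hpx n).enorm]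
    refine le_of_le_of_eq ?_ (lintegral_const_mul'' _
      ((hmeas hpx n).enorm.add (hmeas hpy n).enorm))
    refine setLIntegral_mono' hK.measurableSet fun z hz ↦ ?_
    have hz' := hR z hz
    rw [← ofReal_norm, ← ofReal_norm, ← ofReal_norm,
      ← ENNReal.ofReal_add (norm_nonneg _) (norm_nonneg _),
      ← ENNReal.ofReal_mul ((norm_nonneg _).trans hz')]
    refine ENNReal.ofReal_le_ofReal ?_
    have : B n z - B₀ z = (deriv f z * v).re • (m px n (f z) - px (f z)) +
        (deriv f z * v).im • (m py n (f z) - py (f z)) := by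
      simp only [B, B₀, smul_sub]; ring
    rw [this, mul_add]
    refine (norm_add_le _ _).trans (add_le_add ?_ ?_) <;> rw [norm_smul] <;> gcongr
    · exact (Complex.abs_re_le_norm _).trans hz'
    · exact (Complex.abs_im_le_norm _).trans hz'
  have hfin : IsFiniteMeasure (volume.restrict K) := ⟨by simpa using hK.measure_lt_top⟩
  -- With `F = id` the outer factor is `1`, and the chain-rule expression reduces to `B₀`.
  have hB₀ : Integrable B₀ (volume.restrict K) := by
    have := (memLp_chainDirDeriv (F := id) (V := Set.univ) hψ hpx hpy hf hinj hd isOpen_univ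
      differentiableOn_id (fun _ _ ↦ trivial) hK hχU v).integrable one_le_two
    exact this.congr (Eventually.of_forall fun z ↦ by simp [chainDirDeriv, B₀])
  have hlim2 := tendsto_integral_mul_of_tendsto_lintegral (μ := volume.restrict K)
    (a := fun n z ↦ χ z • deriv F (m ψ n (f z))) (A := fun z ↦ χ z • deriv F (ψ (f z)))
    (b := B) (B := B₀) (M := (⨆ z, ‖χ z‖) * M')
    (by
      filter_upwards [hmT] with n hn
      exact (hχ.continuous.continuousOn.smul (hcomp hF'c hn)).aestronglyMeasurable
        hK.measurableSet)
    (by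
      filter_upwards [hmT] with n hn
      refine ae_restrict_of_forall_mem hK.measurableSet fun z hz ↦ ?_
      rw [norm_smul]
      have h1 : ‖χ z‖ ≤ ⨆ z, ‖χ z‖ :=
        le_ciSup (hχ.continuous.norm.bddAbove_range_of_hasCompactSupport hχc.norm) z
      exact mul_le_mul h1 (hM' _ (hn z hz)) (norm_nonneg _) ((norm_nonneg _).trans h1))
    (by
      refine ae_restrict_of_forall_mem hK.measurableSet fun z hz ↦ ?_
      exact (((hF'c.continuousAt (hnV z hz)).tendsto).comp (hptw z hz)).const_smul _)
    (Eventually.of_forall fun n ↦ (hBc n).continuousOn.integrableOn_compact hK)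
    hB₀ hBL1
  have hfinal := tendsto_nhds_unique (hlim1.congr' hparts) hlim2.neg
  rw [setIntegral_eq_integral_of_forall_compl_eq_zero (fun z hz ↦ by simp [hχ'0 z hz]),
    setIntegral_eq_integral_of_forall_compl_eq_zero (fun z hz ↦ by simp [hχ0 z hz])] at hfinal
  rw [hfinal]
  congr 1
  refine integral_congr_ae (Eventually.of_forall fun z ↦ ?_)
  simp only [chainDirDeriv, B₀, smul_mul_assoc]

/-! ### Gluing and the Beltrami inequality -/

open Metric in
/-- Weak derivatives on the discs of integral radius around the origin glue to a global one. -/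
theorem exists_isWeakDirDeriv_of_ball {φ : ℂ → ℂ} {v : ℂ} {g : ℕ → ℂ → ℂ}
    (hL : ∀ n : ℕ, MemLp (g n) 2 (volume.restrict (ball 0 n)))
    (hw : ∀ n : ℕ, IsWeakDirDerivOn (ball 0 n) φ v (g n)) :
    ∃ G : ℂ → ℂ, IsLocallyL2 G ∧ IsWeakDirDeriv φ v G ∧
      ∀ n : ℕ, ∀ᵐ z, z ∈ ball (0 : ℂ) n → G z = g n z := by
  have hint : ∀ n : ℕ, IntegrableOn (g n) (ball 0 n) := fun n ↦ by
    have : IsFiniteMeasure (volume.restrict (ball (0 : ℂ) n)) :=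
      ⟨by rw [Measure.restrict_apply_univ]; exact measure_ball_lt_top⟩
    exact (hL n).integrable one_le_two
  have hballmono : ∀ {p n : ℕ}, p ≤ n → ball (0 : ℂ) p ⊆ ball 0 n := fun h ↦
    ball_subset_ball (by exact_mod_cast h)
  have hsmul : ∀ {n : ℕ} {χ : ℂ → ℝ}, ContDiff ℝ ∞ χ → HasCompactSupport χ →
      tsupport χ ⊆ ball 0 n → Integrable fun z ↦ χ z • g n z := fun {n χ} hχ hχc hχn ↦ by
    refine (integrableOn_iff_integrable_of_support_subset (s := tsupport χ)
      (fun z hz ↦ subset_tsupport _ (left_ne_zero_of_smul hz))).1 ?_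
    exact ((hint n).mono_set hχn).continuousOn_smul hχ.continuous.continuousOn hχc
  -- Weak derivatives are unique almost everywhere, by the fundamental lemma of the calculus of
  -- variations.
  have huniq : ∀ p n : ℕ, p ≤ n → ∀ᵐ z, z ∈ ball (0 : ℂ) p → g p z = g n z := by
    intro p n hpn
    have h := isOpen_ball.ae_eq_zero_of_integral_contDiff_smul_eq_zero (μ := volume)
      (U := ball (0 : ℂ) p) (f := fun z ↦ g p z - g n z)
      ((hint p).sub ((hint n).mono_set (hballmono hpn))).locallyIntegrableOn
      fun χ hχ hχc hχp ↦ by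
        have h1 := hw p χ hχ hχc hχp
        have h2 := hw n χ hχ hχc (hχp.trans (hballmono hpn))
        simp only [smul_sub]
        rw [integral_sub (hsmul hχ hχc hχp) (hsmul hχ hχc (hχp.trans (hballmono hpn))), sub_eq_zero]
        exact neg_injective (h1.symm.trans h2)
    filter_upwards [h] with z hz hzp using sub_eq_zero.1 (hz hzp)
  -- `⌊‖z‖⌋₊ + 1` is the least integer radius whose open disc contains `z`.
  have hG : ∀ n : ℕ, ∀ᵐ z, z ∈ ball (0 : ℂ) n → g (⌊‖z‖⌋₊ + 1) z = g n z := by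
    intro n
    have hall : ∀ᵐ z, ∀ p n : ℕ, p ≤ n → z ∈ ball (0 : ℂ) p → g p z = g n z := by
      refine ae_all_iff.2 fun p ↦ ae_all_iff.2 fun n ↦ ?_
      by_cases hpn : p ≤ n
      · filter_upwards [huniq p n hpn] with z hz _ using hz
      · exact Filter.Eventually.of_forall fun z h ↦ absurd h hpn
    filter_upwards [hall] with z hz hzn
    rw [mem_ball_zero_iff] at hzn
    refine hz _ n ((Nat.floor_lt (norm_nonneg z)).2 hzn) ?_
    rw [mem_ball_zero_iff]
    exact_mod_cast Nat.lt_floor_add_one ‖z‖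
  have hcov : ∀ K : Set ℂ, IsCompact K → ∃ n : ℕ, K ⊆ ball 0 n := fun K hK ↦ by
    obtain ⟨r, hr⟩ := hK.isBounded.subset_ball (0 : ℂ)
    obtain ⟨n, hn⟩ := exists_nat_ge r
    exact ⟨n, hr.trans (ball_subset_ball hn)⟩
  refine ⟨fun z ↦ g (⌊‖z‖⌋₊ + 1) z, fun K hK ↦ ?_, fun χ hχ hχc ↦ ?_, hG⟩
  · obtain ⟨n, hn⟩ := hcov K hK
    refine ((hL n).mono_measure (Measure.restrict_mono hn le_rfl)).ae_eq ?_
    refine (ae_restrict_iff' hK.measurableSet).2 ?_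
    filter_upwards [hG n] with z hz hzK using (hz (hn hzK)).symm
  · obtain ⟨n, hn⟩ := hcov _ hχc
    rw [hw n χ hχ hχc hn]
    congr 1
    refine integral_congr_ae ?_
    filter_upwards [hG n] with z hz
    by_cases hzn : z ∈ tsupport χ
    · simp only [hz (hn hzn)]
    · simp [image_eq_zero_of_notMem_tsupport hzn]

/-- Together with the companion identity for the other sign, this shows that `∂̄` acquires the
factor `F' * conj f'` and `∂` the factor `F' * f'`. Their moduli agree, so the Beltrami constant is
unchanged. -/
theorem chainDirDeriv_add_I_mul (F ψ f px py : ℂ → ℂ) (z : ℂ) :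
    chainDirDeriv F ψ f px py 1 z + Complex.I * chainDirDeriv F ψ f px py Complex.I z =
      deriv F (ψ (f z)) * starRingEnd ℂ (deriv f z) * (px (f z) + Complex.I * py (f z)) := by
  have h : starRingEnd ℂ (deriv f z) = (deriv f z).re - (deriv f z).im * Complex.I := by
    apply Complex.ext <;> simp
  simp only [chainDirDeriv, h, mul_one, Complex.mul_I_re, Complex.mul_I_im, Complex.real_smul,
    Complex.ofReal_neg]
  linear_combination (deriv F (ψ (f z)) * (deriv f z).im * py (f z)) * Complex.I_sq

theorem chainDirDeriv_sub_I_mul (F ψ f px py : ℂ → ℂ) (z : ℂ) :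
    chainDirDeriv F ψ f px py 1 z - Complex.I * chainDirDeriv F ψ f px py Complex.I z =
      deriv F (ψ (f z)) * deriv f z * (px (f z) - Complex.I * py (f z)) := by
  have h : deriv f z = (deriv f z).re + (deriv f z).im * Complex.I := (Complex.re_add_im _).symm
  have h' : deriv F (ψ (f z)) * deriv f z * (px (f z) - Complex.I * py (f z)) =
    deriv F (ψ (f z)) * ((deriv f z).re + (deriv f z).im * Complex.I) *
      (px (f z) - Complex.I * py (f z)) := by rw [← h]
  rw [h']
  simp only [chainDirDeriv, mul_one, Complex.mul_I_re, Complex.mul_I_im, Complex.real_smul,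
    Complex.ofReal_neg]
  linear_combination (deriv F (ψ (f z)) * (deriv f z).im * py (f z)) * Complex.I_sq

open Metric in
/-- A homeomorphism that agrees on every disc around the origin with `F ∘ ψ ∘ f`, where `ψ` is
quasiconformal and `F`, `f` are conformal, is quasiconformal. -/
theorem IsQuasiconformal.of_eq_comp {ψ φ : ℂ ≃ₜ ℂ} (hψ : IsQuasiconformal ψ)
    (h : ∀ n : ℕ, ∃ (F f : ℂ → ℂ) (U V : Set ℂ), closedBall 0 n ⊆ U ∧ Differentiable ℂ f ∧
      Set.InjOn f U ∧ (∀ z ∈ U, deriv f z ≠ 0) ∧ IsOpen V ∧ DifferentiableOn ℂ F V ∧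
      ∀ z ∈ U, ψ (f z) ∈ V ∧ φ z = F (ψ (f z))) :
    IsQuasiconformal φ := by
  obtain ⟨px, py, hpx, hpy, hwx, hwy, k, hk0, hk1, hk⟩ := hψ
  choose F f U V hU hf hinj hd hV hF hUV using h
  set g : ℂ → ℕ → ℂ → ℂ := fun v n ↦ chainDirDeriv (F n) ψ (f n) px py v
  have hL : ∀ v, ∀ n : ℕ, MemLp (g v n) 2 (volume.restrict (ball 0 n)) := fun v n ↦
    (memLp_chainDirDeriv ψ.continuous hpx hpy (hf n) (hinj n) (hd n) (hV n) (hF n)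
      (fun z hz ↦ (hUV n z hz).1) (isCompact_closedBall 0 n) (hU n) v).mono_measure
      (Measure.restrict_mono ball_subset_closedBall le_rfl)
  have hw : ∀ v, ∀ n : ℕ, IsWeakDirDerivOn (ball 0 n) φ v (g v n) := fun v n χ hχ hχc hχn ↦ by
    have hχU : tsupport χ ⊆ U n := hχn.trans (ball_subset_closedBall.trans (hU n))
    rw [← isWeakDirDerivOn_comp ψ.continuous hpx hpy hwx hwy (hf n) (hinj n) (hd n) (hV n) (hF n)
      (fun z hz ↦ (hUV n z hz).1) v χ hχ hχc hχU]
    congr 1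
    ext z
    by_cases hz : z ∈ tsupport χ
    · rw [(hUV n z (hχU hz)).2]
    · rw [image_eq_zero_of_notMem_tsupport (f := fderiv ℝ χ)
        (fun h ↦ hz (tsupport_fderiv_subset ℝ h))]
      simp
  obtain ⟨Gx, hGxL, hGxw, hGx⟩ := exists_isWeakDirDeriv_of_ball (hL 1) (hw 1)
  obtain ⟨Gy, hGyL, hGyw, hGy⟩ := exists_isWeakDirDeriv_of_ball (hL Complex.I) (hw Complex.I)
  refine ⟨Gx, Gy, hGxL, hGyL, hGxw, hGyw, k, hk0, hk1, ?_⟩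
  have hkn : ∀ n : ℕ, ∀ᵐ z, z ∈ ball (0 : ℂ) n →
      ‖(px (f n z) + Complex.I * py (f n z)) / 2‖ ≤
        k * ‖(px (f n z) - Complex.I * py (f n z)) / 2‖ := fun n ↦ by
    obtain ⟨C, -, hle⟩ := exists_map_restrict_volume_le (hf n) (isCompact_closedBall 0 (n : ℝ))
      ((hinj n).mono (hU n)) fun z hz ↦ hd n z (hU n hz)
    -- By absolute continuity, the null set where the inequality for `ψ` fails pulls back to a null
    -- set.
    have hac : (volume.restrict (closedBall (0 : ℂ) n)).map (f n) ≪ volume :=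
      (hle.absolutelyContinuous.trans Measure.smul_absolutelyContinuous).trans
        Measure.restrict_le_self.absolutelyContinuous
    have h1 := ae_of_ae_map (hf n).continuous.aemeasurable (hac.ae_le hk)
    filter_upwards [(ae_restrict_iff' isClosed_closedBall.measurableSet).1 h1] with z hz hzn
    exact hz (ball_subset_closedBall hzn)
  filter_upwards [ae_all_iff.2 hGx, ae_all_iff.2 hGy, ae_all_iff.2 hkn] with z h1 h2 h3
  obtain ⟨n, hn⟩ := exists_nat_gt ‖z‖
  have hzn : z ∈ ball (0 : ℂ) n := mem_ball_zero_iff.2 hn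
  rw [h1 n hzn, h2 n hzn]
  simp only [g]
  rw [chainDirDeriv_add_I_mul, chainDirDeriv_sub_I_mul, mul_div_assoc, mul_div_assoc, norm_mul,
    norm_mul, norm_mul, norm_mul, RCLike.norm_conj]
  calc _ ≤ ‖deriv (F n) (ψ (f n z))‖ * ‖deriv (f n) z‖ *
        (k * ‖(px (f n z) - Complex.I * py (f n z)) / 2‖) := by gcongr; exact h3 n hzn
    _ = _ := by ring

/-! ### Repelling fixed points under conjugacy -/

open Filter Topology Metric in
/-- An entire function has a holomorphic local inverse at every noncritical point. -/
theorem exists_openPartialHomeomorph_of_deriv_ne_zero {f : ℂ → ℂ} (hf : Differentiable ℂ f)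
    {a : ℂ} (ha : deriv f a ≠ 0) :
    ∃ e : OpenPartialHomeomorph ℂ ℂ, a ∈ e.source ∧ (∀ z, e z = f z) ∧
      (∀ z ∈ e.source, deriv f z ≠ 0) ∧ DifferentiableOn ℂ e.symm e.target := by
  have hs : HasStrictDerivAt f (deriv f a) a :=
    (hf.contDiff (n := 1)).contDiffAt.hasStrictDerivAt one_ne_zero
  have hdf : Continuous (deriv f) := (hf.contDiff (n := 1)).continuous_deriv_one
  set e₀ := (hs.hasStrictFDerivAt_equiv ha).toOpenPartialHomeomorph f
  -- Removing the critical points makes the inverse holomorphic on the whole target.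
  have hO : IsOpen {z | deriv f z ≠ 0} := isOpen_ne_fun hdf continuous_const
  set e := e₀.restrOpen _ hO
  have hsrc : ∀ z, z ∈ e.source ↔ z ∈ e₀.source ∧ deriv f z ≠ 0 := fun z ↦ by
    rw [e₀.restrOpen_source]; rfl
  refine ⟨e, (hsrc a).2 ⟨(hs.hasStrictFDerivAt_equiv ha).mem_toOpenPartialHomeomorph_source, ha⟩,
    fun z ↦ rfl, fun z hz ↦ ((hsrc z).1 hz).2, fun w hw ↦ ?_⟩
  have h := e.hasDerivAt_symm hw ((hsrc _).1 (e.map_target hw)).2 (hf (e.symm w)).hasDerivAt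
  exact h.differentiableAt.differentiableWithinAt

open Filter Topology in
theorem HasDerivAt.eventually_norm_sub_le {g : ℂ → ℂ} {d a : ℂ} (hg : HasDerivAt g d a) {c : ℝ}
    (hc : ‖d‖ < c) : ∀ᶠ z in 𝓝 a, ‖g z - g a‖ ≤ c * ‖z - a‖ := by
  filter_upwards [(hasDerivAt_iff_isLittleO.1 hg).def (sub_pos.2 hc)] with z hz
  calc ‖g z - g a‖ = ‖(g z - g a - (z - a) • d) + (z - a) • d‖ := by rw [sub_add_cancel]
    _ ≤ (c - ‖d‖) * ‖z - a‖ + ‖z - a‖ * ‖d‖ :=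
      (norm_add_le _ _).trans (add_le_add hz (norm_smul_le _ _))
    _ = c * ‖z - a‖ := by ring

open Filter Topology Metric in
/-- Repelling fixed points of entire functions are preserved by topological conjugacy. -/
theorem IsRepellingFixedPoint.of_conj {h₁ h₂ : ℂ → ℂ} (hh₁ : Differentiable ℂ h₁)
    (hh₂ : Differentiable ℂ h₂) (ψ : ℂ ≃ₜ ℂ) (hψ : ∀ z, ψ (h₁ z) = h₂ (ψ z)) {x : ℂ}
    (hx : IsRepellingFixedPoint h₁ x) : IsRepellingFixedPoint h₂ (ψ x) := by
  obtain ⟨hfix, hrep⟩ := hx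
  have hfix₂ : h₂ (ψ x) = ψ x := by rw [← hψ, hfix]
  refine ⟨hfix₂, ?_⟩
  have hne : deriv h₁ x ≠ 0 := norm_pos_iff.1 (one_pos.trans hrep)
  obtain ⟨e, hxe, he, -, -⟩ := exists_openPartialHomeomorph_of_deriv_ne_zero hh₁ hne
  set g := e.symm
  have hgx : g x = x := by
    have := e.left_inv hxe
    rwa [he, hfix] at this
  have hxt : x ∈ e.target := by
    have := e.map_source hxe
    rwa [he, hfix] at this
  have hgd : HasDerivAt g (deriv h₁ x)⁻¹ x := e.hasDerivAt_symm hxt hne (by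
    rw [show e.symm x = x from hgx, show (e : ℂ → ℂ) = h₁ from funext he]
    exact (hh₁ x).hasDerivAt)
  have hinv : ‖(deriv h₁ x)⁻¹‖ < 1 := by rw [norm_inv]; exact inv_lt_one_of_one_lt₀ hrep
  obtain ⟨c, hdc, hc1⟩ := exists_between hinv
  have hc0 : 0 ≤ c := (norm_nonneg _).trans hdc.le
  have hgc := hgd.eventually_norm_sub_le hdc
  rw [hgx] at hgc
  have hcpow : Tendsto (fun n : ℕ ↦ c ^ n) atTop (𝓝 0) :=
    tendsto_pow_atTop_nhds_zero_of_lt_one hc0 hc1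
  -- If `ψ x` were critical, `h₂` would map a small disc into itself, while `h₁` expands distances
  -- to `x` by at least `1 / c`. Orbits in the disc correspond under `ψ⁻¹` to orbits staying within
  -- `1` of `x`, so they would all start at `x`.
  by_cases hne₂ : deriv h₂ (ψ x) = 0
  · exfalso
    have hcontr := (hh₂ (ψ x)).hasDerivAt.eventually_norm_sub_le (c := 1) (by simp [hne₂])
    have h1 : ∀ᶠ z in 𝓝 x, ‖z - x‖ ≤ c * ‖h₁ z - x‖ ∧ ‖h₁ z - x‖ < 1 := by
      have ht : Tendsto h₁ (𝓝 x) (𝓝 x) := by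
        simpa [hfix] using (hh₁ x).continuousAt.tendsto
      have hb : ∀ᶠ z in 𝓝 x, ‖z - x‖ < 1 := by
        filter_upwards [ball_mem_nhds x one_pos] with z hz using mem_ball_iff_norm.1 hz
      filter_upwards [ht.eventually hgc, e.open_source.mem_nhds hxe, ht.eventually hb]
        with z hz hze hzb
      refine ⟨?_, hzb⟩
      have := e.left_inv hze
      rw [he] at this
      rwa [show g (h₁ z) = z from this] at hz
    have h2 : ∀ᶠ w in 𝓝 (ψ x), ‖ψ.symm w - x‖ ≤ c * ‖h₁ (ψ.symm w) - x‖ ∧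
        ‖h₁ (ψ.symm w) - x‖ < 1 := by
      have : Tendsto ψ.symm (𝓝 (ψ x)) (𝓝 x) := by
        simpa using ψ.symm.continuous.tendsto (ψ x)
      exact this.eventually h1
    obtain ⟨s, hs, hsb⟩ := Metric.eventually_nhds_iff_ball.1 (hcontr.and h2)
    rw [hfix₂] at hsb
    have hmaps : Set.MapsTo h₂ (ball (ψ x) s) (ball (ψ x) s) := fun w hw ↦ by
      have := (hsb w hw).1
      rw [one_mul] at this
      rw [mem_ball_iff_norm] at hw ⊢
      exact this.trans_lt hw
    have hiter : ∀ n : ℕ, ∀ w ∈ ball (ψ x) s, ‖ψ.symm w - x‖ ≤ c ^ (n + 1) := by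
      intro n
      induction n with
      | zero =>
        intro w hw
        obtain ⟨-, h3, h4⟩ := hsb w hw
        rw [zero_add, pow_one]
        nlinarith
      | succ n ih =>
        intro w hw
        have h3 := (hsb w hw).2.1
        have h4 := ih (h₂ w) (hmaps hw)
        have h5 : ψ.symm (h₂ w) = h₁ (ψ.symm w) := by
          rw [ψ.symm_apply_eq, hψ, ψ.apply_symm_apply]
        rw [h5] at h4
        calc _ ≤ c * ‖h₁ (ψ.symm w) - x‖ := h3
          _ ≤ c * c ^ (n + 1) := by gcongr
          _ = c ^ (n + 1 + 1) := by ring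
    have hw : ψ x + (s / 2 : ℝ) ∈ ball (ψ x) s := by
      rw [mem_ball_iff_norm, add_sub_cancel_left, Complex.norm_real, Real.norm_eq_abs,
        abs_of_pos (by positivity)]
      linarith
    have h6 : ‖ψ.symm (ψ x + (s / 2 : ℝ)) - x‖ ≤ 0 :=
      ge_of_tendsto' ((tendsto_add_atTop_iff_nat 1).2 hcpow) fun n ↦ hiter n _ hw
    have h7 : ψ x + (s / 2 : ℝ) = ψ x :=
      ψ.symm_apply_eq.1 (sub_eq_zero.1 (norm_le_zero_iff.1 h6))
    have h8 : ((s / 2 : ℝ) : ℂ) = 0 := by simpa using h7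
    have : s / 2 = 0 := by exact_mod_cast h8
    linarith
  · have hd₂ : ∀ᶠ z in 𝓝 x, deriv h₂ (ψ (g z)) ≠ 0 := by
      have hcont : ContinuousAt (fun z ↦ deriv h₂ (ψ (g z))) x :=
        (hh₂.contDiff (n := 1)).continuous_deriv_one.continuousAt.comp
          (ψ.continuous.continuousAt.comp hgd.continuousAt)
      exact hcont.eventually_ne (by rwa [hgx])
    obtain ⟨r, hr, hball⟩ := Metric.eventually_nhds_iff_ball.1
      ((hgc.and hd₂).and (e.open_target.mem_nhds hxt))
    have hgmaps : Set.MapsTo g (ball x r) (ball x r) := fun z hz ↦ by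
      have := (hball z hz).1.1
      rw [mem_ball_iff_norm] at hz ⊢
      nlinarith [norm_nonneg (z - x)]
    have hgiter : ∀ n : ℕ, ∀ z ∈ ball x r, ‖g^[n] z - x‖ ≤ c ^ n * r := by
      intro n
      induction n with
      | zero => intro z hz; simpa using (mem_ball_iff_norm.1 hz).le
      | succ n ih =>
        intro z hz
        rw [Function.iterate_succ_apply']
        have h3 := (hball _ (hgmaps.iterate n hz)).1.1
        calc _ ≤ c * ‖g^[n] z - x‖ := h3
          _ ≤ c * (c ^ n * r) := by gcongr; exact ih z hz
          _ = c ^ (n + 1) * r := by ring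
    -- `G` is a continuous right inverse of `h₂` on `W` with noncritical values, hence holomorphic
    -- there.
    set G : ℂ → ℂ := fun w ↦ ψ (g (ψ.symm w))
    set W : Set ℂ := ψ.symm ⁻¹' ball x r
    have hW : IsOpen W := isOpen_ball.preimage ψ.symm.continuous
    have hxW : ψ x ∈ W := by simpa [W] using hr
    have hGmaps : Set.MapsTo G W W := fun w hw ↦ by
      simpa [W, G] using hgmaps hw
    have hGd : ∀ w ∈ W, HasDerivAt G (deriv h₂ (G w))⁻¹ w := fun w hw ↦ by
      refine HasDerivAt.of_local_left_inverse ?_ (hh₂ _).hasDerivAt (hball _ hw).1.2 ?_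
      · exact ψ.continuous.continuousAt.comp
          ((e.symm.continuousAt (hball _ hw).2).comp ψ.symm.continuous.continuousAt)
      · filter_upwards [hW.mem_nhds hw] with y hy
        have h3 := e.right_inv (hball _ hy).2
        rw [he] at h3
        rw [← hψ, show h₁ (g (ψ.symm y)) = ψ.symm y from h3, ψ.apply_symm_apply]
    have hGx : G (ψ x) = ψ x := by simp [G, hgx]
    have hGn : ∀ (n : ℕ) (w : ℂ), G^[n] w = ψ (g^[n] (ψ.symm w)) := by
      intro n
      induction n with
      | zero => simp
      | succ n ih =>
        intro w
        rw [Function.iterate_succ_apply', Function.iterate_succ_apply', ih]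
        simp [G]
    obtain ⟨s, hs, hsW⟩ := nhds_basis_closedBall.mem_iff.1 (hW.mem_nhds hxW)
    -- With `s / 2` as bound for `G^[n] - ψ x` on the circle of radius `s`, Cauchy's estimate bounds
    -- the `n`-th power of the multiplier by `1 / 2`.
    obtain ⟨δ, hδ, hψδ⟩ := Metric.continuousAt_iff.1
      (ψ.continuous.continuousAt (x := x)) (s / 2) (by positivity)
    have hcr : Tendsto (fun n : ℕ ↦ c ^ n * r) atTop (𝓝 0) := by simpa using hcpow.mul_const r
    obtain ⟨n, hn⟩ := (hcr.eventually (gt_mem_nhds hδ)).exists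
    have hdiff : DifferentiableOn ℂ (fun w ↦ G^[n] w - ψ x) W :=
      (DifferentiableOn.iterate
        (fun w hw ↦ (hGd w hw).differentiableAt.differentiableWithinAt) hGmaps n).sub_const _
    have hcauchy := Complex.norm_deriv_le_of_forall_mem_sphere_norm_le (c := ψ x) (C := s / 2) hs
      (hdiff.diffContOnCl_ball hsW) fun w hw ↦ by
        rw [hGn, ← dist_eq_norm]
        refine (hψδ ?_).le
        rw [dist_eq_norm]
        exact (hgiter n _ (hsW (sphere_subset_closedBall hw))).trans_lt hn
    have hder := HasDerivAt.iterate (ψ x) (hGd _ hxW) hGx n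
    rw [deriv_sub_const, hder.deriv, hGx, norm_pow, norm_inv] at hcauchy
    by_contra! hle
    have h1 : 1 ≤ ‖deriv h₂ (ψ x)‖⁻¹ := (one_le_inv₀ (norm_pos_iff.2 hne₂)).2 hle
    have h2 : (1 : ℝ) ≤ ‖deriv h₂ (ψ x)‖⁻¹ ^ n := one_le_pow₀ h1
    have h3 : s / 2 / s = 1 / 2 := by field_simp
    rw [h3] at hcauchy
    linarith

/-! ### Lifting the conjugacy through the Poincaré functions -/

open Filter Topology in
theorem tendsto_div_pow_atTop_of_one_lt_norm {a : ℂ} (ha : 1 < ‖a‖) (z : ℂ) :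
    Tendsto (fun n : ℕ ↦ z / a ^ n) atTop (𝓝 0) := by
  have h : Tendsto (fun n : ℕ ↦ z * a⁻¹ ^ n) atTop (𝓝 (z * 0)) :=
    (tendsto_pow_atTop_nhds_zero_of_norm_lt_one (by
      rw [norm_inv]; exact inv_lt_one_of_one_lt₀ ha)).const_mul z
  simpa [div_eq_mul_inv] using h

open Filter Topology in
/-- A property that holds near `0` and is preserved by `z ↦ a * z`, `‖a‖ > 1`, holds everywhere. -/
theorem forall_of_eventually_of_mul {a : ℂ} (ha : 1 < ‖a‖) {p : ℂ → Prop}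
    (h0 : ∀ᶠ z in 𝓝 0, p z) (hmul : ∀ z, p z → p (a * z)) (z : ℂ) : p z := by
  have ha0 : a ≠ 0 := norm_pos_iff.1 (one_pos.trans ha)
  obtain ⟨n, hn⟩ := ((tendsto_div_pow_atTop_of_one_lt_norm ha z).eventually h0).exists
  have h : ∀ k : ℕ, p (a ^ k * (z / a ^ n)) := fun k ↦ by
    induction k with
    | zero => simpa using hn
    | succ k ih =>
      have := hmul _ ih
      rwa [← mul_assoc, ← pow_succ'] at this
  have := h n
  rwa [mul_div_cancel₀ _ (pow_ne_zero n ha0)] at this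

open Filter Topology in
/-- A germ at `0` that semiconjugates `z ↦ a * z`, `‖a‖ > 1`, to `z ↦ d * z` extends to the
plane. -/
theorem exists_extension_of_eventually_semiconj {a d : ℂ} (ha : 1 < ‖a‖) {p : ℂ → ℂ}
    (hp : ∀ᶠ z in 𝓝 0, p (a * z) = d * p z) :
    ∃ P : ℂ → ℂ, (∀ᶠ z in 𝓝 0, P z = p z) ∧ ∀ z, P (a * z) = d * P z := by
  have ha0 : a ≠ 0 := norm_pos_iff.1 (one_pos.trans ha)
  obtain ⟨δ, hδ, hpδ⟩ := Metric.eventually_nhds_iff_ball.1 hp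
  have hex : ∀ z : ℂ, ∃ n : ℕ, z / a ^ n ∈ Metric.ball (0 : ℂ) δ := fun z ↦
    ((tendsto_div_pow_atTop_of_one_lt_norm ha z).eventually (Metric.ball_mem_nhds 0 hδ)).exists
  -- The value `d ^ m * p (z / a ^ m)` does not change as `m` grows, once `z / a ^ m` is in the
  -- disc; so the extension is independent of the chosen exponent.
  have hstep : ∀ (z : ℂ) (m : ℕ), z / a ^ m ∈ Metric.ball (0 : ℂ) δ → ∀ j : ℕ,
      z / a ^ (m + j) ∈ Metric.ball (0 : ℂ) δ ∧
        d ^ (m + j) * p (z / a ^ (m + j)) = d ^ m * p (z / a ^ m) := by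
    intro z m hm j
    induction j with
    | zero => exact ⟨hm, rfl⟩
    | succ j ih =>
      have hmul : z / a ^ (m + j) = a * (z / a ^ (m + (j + 1))) := by
        rw [← add_assoc, pow_succ]; field_simp
      have hmem : z / a ^ (m + (j + 1)) ∈ Metric.ball (0 : ℂ) δ := by
        have h1 := ih.1
        rw [hmul, mem_ball_zero_iff, norm_mul] at h1
        rw [mem_ball_zero_iff]
        nlinarith [norm_nonneg (z / a ^ (m + (j + 1)))]
      refine ⟨hmem, ?_⟩
      rw [← ih.2, hmul, hpδ _ hmem]
      ring
  choose N hN using hex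
  have key : ∀ (z : ℂ) (n : ℕ), z / a ^ n ∈ Metric.ball (0 : ℂ) δ →
      d ^ N z * p (z / a ^ N z) = d ^ n * p (z / a ^ n) := fun z n hn ↦ by
    have h1 := (hstep z n hn (N z)).2
    have h2 := (hstep z (N z) (hN z) n).2
    rw [add_comm (N z) n] at h2
    exact h2.symm.trans h1
  refine ⟨fun z ↦ d ^ N z * p (z / a ^ N z), ?_, fun z ↦ ?_⟩
  · filter_upwards [Metric.ball_mem_nhds 0 hδ] with z hz
    simpa using key z 0 (by simpa using hz)
  · have h1 : a * z / a ^ (N z + 1) = z / a ^ N z := by rw [pow_succ]; field_simp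
    have h2 := key (a * z) (N z + 1) (by rw [h1]; exact hN z)
    simp only [h2, h1]
    ring

open Filter Topology in
/-- A conjugacy between entire functions lifts through their Poincaré functions to a continuous
map of the plane that semiconjugates the multipliers. -/
theorem exists_lift_poincareFunction {h₁ h₂ f₁ f₂ ψ : ℂ → ℂ} {x₁ x₂ : ℂ}
    (hψc : Continuous ψ) (hψ : ∀ z, ψ (h₁ z) = h₂ (ψ z)) (hx : ψ x₁ = x₂)
    (hrep : IsRepellingFixedPoint h₁ x₁)
    (hf₁ : IsPoincareFunction h₁ x₁ f₁) (hf₂ : IsPoincareFunction h₂ x₂ f₂)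
    {e : OpenPartialHomeomorph ℂ ℂ} (he0 : 0 ∈ e.source) (he : ∀ z, e z = f₂ z) :
    ∃ P : ℂ → ℂ, Continuous P ∧ (∀ᶠ z in 𝓝 0, P z = e.symm (ψ (f₁ z))) ∧
      (∀ z, P (deriv h₁ x₁ * z) = deriv h₂ x₂ * P z) ∧ ∀ z, ψ (f₁ z) = f₂ (P z) := by
  obtain ⟨-, ha⟩ := hrep
  obtain ⟨hf₁d, hf₁0, -, hf₁e⟩ := hf₁
  obtain ⟨hf₂d, hf₂0, -, hf₂e⟩ := hf₂
  set a := deriv h₁ x₁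
  set d := deriv h₂ x₂
  have ha0 : a ≠ 0 := norm_pos_iff.1 (one_pos.trans ha)
  set p : ℂ → ℂ := fun z ↦ e.symm (ψ (f₁ z))
  have hx₂ : x₂ ∈ e.target := by
    have := e.map_source he0
    rwa [he, hf₂0] at this
  have hex₂ : e.symm x₂ = 0 := by
    have := e.left_inv he0
    rwa [he, hf₂0] at this
  have hψf : Continuous fun z ↦ ψ (f₁ z) := hψc.comp hf₁d.continuous
  have htarget : ∀ᶠ z in 𝓝 0, ψ (f₁ z) ∈ e.target :=
    hψf.continuousAt.eventually (e.open_target.mem_nhds (by simpa [hf₁0, hx] using hx₂))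
  have hpc : ∀ᶠ z in 𝓝 0, ContinuousAt p z := by
    filter_upwards [htarget] with z hz
    exact ContinuousAt.comp (f := fun z ↦ ψ (f₁ z)) (e.symm.continuousAt hz) hψf.continuousAt
  have hp0 : p 0 = 0 := by simp [p, hf₁0, hx, hex₂]
  have hpf : ∀ z, ψ (f₁ z) ∈ e.target → f₂ (p z) = ψ (f₁ z) := fun z hz ↦ by
    rw [← he]; exact e.right_inv hz
  have hfun : ∀ z w, ψ (f₁ z) = f₂ w → ψ (f₁ (a * z)) = f₂ (d * w) := fun z w hzw ↦ by
    rw [hf₁e, hf₂e, hψ, hzw]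
  -- Near `0` both sides lie in `e.source` and have the same image under `f₂`, which is injective
  -- there.
  have hsemi : ∀ᶠ z in 𝓝 0, p (a * z) = d * p z := by
    have h1 : ∀ᶠ z in 𝓝 0, ψ (f₁ (a * z)) ∈ e.target := by
      have : Tendsto (fun z ↦ a * z) (𝓝 0) (𝓝 0) := by
        simpa using (continuous_const_mul a).tendsto 0
      exact this.eventually htarget
    have h2 : ∀ᶠ z in 𝓝 0, d * p z ∈ e.source := by
      have : ContinuousAt (fun z ↦ d * p z) 0 := continuousAt_const.mul hpc.self_of_nhds
      exact this.eventually (e.open_source.mem_nhds (by simpa [hp0] using he0))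
    filter_upwards [htarget, h1, h2] with z hz hz1 hz2
    refine e.injOn (e.map_target hz1) hz2 ?_
    rw [he, he, hpf _ hz1]
    exact hfun z _ (hpf z hz).symm
  obtain ⟨P, hP, hPe⟩ := exists_extension_of_eventually_semiconj ha hsemi
  refine ⟨P, continuous_iff_continuousAt.2 ?_, hP, hPe, ?_⟩
  · refine forall_of_eventually_of_mul ha ?_ fun z hz ↦ ?_
    · filter_upwards [hpc, hP.eventually_nhds] with z hz hz' using hz.congr (EventuallyEq.symm hz')
    · have hPw : P = fun w ↦ d * P (a⁻¹ * w) := funext fun w ↦ by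
        rw [← hPe, mul_inv_cancel_left₀ ha0]
      rw [hPw]
      refine continuousAt_const.mul (ContinuousAt.comp (f := fun w ↦ a⁻¹ * w) ?_
        (continuous_const_mul a⁻¹).continuousAt)
      rwa [inv_mul_cancel_left₀ ha0]
  · refine forall_of_eventually_of_mul ha ?_ fun z hz ↦ ?_
    · filter_upwards [htarget, hP] with z hz hz'
      rw [hz', hpf z hz]
    · rw [hPe]; exact hfun z _ hz

open Filter Topology in
/-- A conjugacy between entire functions lifts through their Poincaré functions to a homeomorphism
that agrees near the origin with a branch of `f₂⁻¹ ∘ ψ ∘ f₁`. -/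
theorem exists_homeomorph_lift_poincareFunction {h₁ h₂ f₁ f₂ : ℂ → ℂ} {x₁ : ℂ} (ψ : ℂ ≃ₜ ℂ)
    (hψ : ∀ z, ψ (h₁ z) = h₂ (ψ z))
    (hrep₁ : IsRepellingFixedPoint h₁ x₁) (hrep₂ : IsRepellingFixedPoint h₂ (ψ x₁))
    (hf₁ : IsPoincareFunction h₁ x₁ f₁) (hf₂ : IsPoincareFunction h₂ (ψ x₁) f₂)
    {e₁ e₂ : OpenPartialHomeomorph ℂ ℂ} (he₁0 : 0 ∈ e₁.source) (he₁ : ∀ z, e₁ z = f₁ z)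
    (he₂0 : 0 ∈ e₂.source) (he₂ : ∀ z, e₂ z = f₂ z) :
    ∃ φ : ℂ ≃ₜ ℂ, (∀ᶠ z in 𝓝 0, φ z = e₂.symm (ψ (f₁ z))) ∧
      (∀ z, φ (deriv h₁ x₁ * z) = deriv h₂ (ψ x₁) * φ z) ∧ ∀ z, ψ (f₁ z) = f₂ (φ z) := by
  have hψ' : ∀ z, ψ.symm (h₂ z) = h₁ (ψ.symm z) := fun z ↦ by
    rw [ψ.symm_apply_eq, hψ, ψ.apply_symm_apply]
  obtain ⟨P, hPc, hP0, hPe, hPf⟩ := exists_lift_poincareFunction ψ.continuous hψ rfl hrep₁ hf₁ hf₂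
    he₂0 he₂
  obtain ⟨Q, hQc, hQ0, hQe, hQf⟩ := exists_lift_poincareFunction ψ.symm.continuous hψ'
    (ψ.symm_apply_apply x₁) hrep₂ hf₂ hf₁ he₁0 he₁
  -- Stated for general data so as to give both `Q ∘ P = id` and, with `ψ.symm`, `P ∘ Q = id` near
  -- `0`.
  have hinv : ∀ {e : OpenPartialHomeomorph ℂ ℂ} {f P Q : ℂ → ℂ} {ψ : ℂ ≃ₜ ℂ} {g : ℂ → ℂ},
      0 ∈ e.source → (∀ z, e z = f z) → Continuous P → P 0 = 0 →
      (∀ᶠ z in 𝓝 0, Q z = e.symm (ψ.symm (g z))) → (∀ z, ψ (f z) = g (P z)) →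
      ∀ᶠ z in 𝓝 0, Q (P z) = z := by
    intro e f P Q ψ g he0 he hP hP0 hQ hf
    have ht : Tendsto P (𝓝 0) (𝓝 0) := by simpa [hP0] using hP.tendsto 0
    filter_upwards [ht.eventually hQ, e.open_source.mem_nhds he0] with z hz hze
    rw [hz, ← hf, ψ.symm_apply_apply, ← he]
    exact e.left_inv hze
  have hzero : ∀ {e : OpenPartialHomeomorph ℂ ℂ} {f P : ℂ → ℂ} {y : ℂ}, 0 ∈ e.source →
      (∀ z, e z = f z) → f 0 = y → P 0 = e.symm y → P 0 = 0 := by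
    intro e f P y he0 he hf hP
    rw [hP, ← hf, ← he]
    exact e.left_inv he0
  have hP00 : P 0 = 0 := hzero he₂0 he₂ hf₂.2.1 (by rw [hP0.self_of_nhds, hf₁.2.1])
  have hQ00 : Q 0 = 0 := hzero he₁0 he₁ hf₁.2.1 (by
    rw [hQ0.self_of_nhds, hf₂.2.1, ψ.symm_apply_apply])
  refine ⟨⟨⟨P, Q, ?_, ?_⟩, hPc, hQc⟩, hP0, hPe, hPf⟩
  · refine forall_of_eventually_of_mul hrep₁.2 (hinv he₁0 he₁ hPc hP00 hQ0 hPf) fun z hz ↦ ?_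
    rw [hPe, hQe, hz]
  · refine forall_of_eventually_of_mul hrep₂.2
      (hinv (ψ := ψ.symm) he₂0 he₂ hQc hQ00 hP0 hQf) fun z hz ↦ ?_
    rw [hQe, hPe, hz]

theorem mainTheorem7 (h₁ h₂ : ℂ → ℂ)
    (hh₁ : Differentiable ℂ h₁) (hh₂ : Differentiable ℂ h₂)
    (hn₁ : ¬ IsAffineMap h₁) (hn₂ : ¬ IsAffineMap h₂)
    (ψ : ℂ ≃ₜ ℂ) (hψ : ∀ z, ψ (h₁ z) = h₂ (ψ z))
    (x₁ : ℂ) (hx₁ : IsRepellingFixedPoint h₁ x₁) :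
    IsRepellingFixedPoint h₂ (ψ x₁) ∧
    ∀ f₁ f₂ : ℂ → ℂ, IsPoincareFunction h₁ x₁ f₁ → IsPoincareFunction h₂ (ψ x₁) f₂ →
      ∃ φ : ℂ ≃ₜ ℂ, (∀ z, ψ (f₁ z) = f₂ (φ z)) ∧
        (IsQuasiconformal ψ → IsQuasiconformal φ) := by
  have hx₂ := hx₁.of_conj hh₁ hh₂ ψ hψ
  refine ⟨hx₂, fun f₁ f₂ hf₁ hf₂ ↦ ?_⟩
  obtain ⟨e₁, he₁0, he₁, he₁d, -⟩ := exists_openPartialHomeomorph_of_deriv_ne_zero hf₁.1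
    (a := 0) (by rw [hf₁.2.2.1]; exact one_ne_zero)
  obtain ⟨e₂, he₂0, he₂, -, he₂s⟩ := exists_openPartialHomeomorph_of_deriv_ne_zero hf₂.1
    (a := 0) (by rw [hf₂.2.2.1]; exact one_ne_zero)
  obtain ⟨φ, hφ0, hφe, hφf⟩ := exists_homeomorph_lift_poincareFunction ψ hψ hx₁ hx₂ hf₁ hf₂
    he₁0 he₁ he₂0 he₂
  refine ⟨φ, hφf, fun hqc ↦ hqc.of_eq_comp fun n ↦ ?_⟩
  set a := deriv h₁ x₁
  set d := deriv h₂ (ψ x₁)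
  have ha : 1 < ‖a‖ := hx₁.2
  have ha0 : a ≠ 0 := norm_pos_iff.1 (one_pos.trans ha)
  have htarget : ∀ᶠ z in nhds 0, ψ (f₁ z) ∈ e₂.target := by
    refine (ψ.continuous.comp hf₁.1.continuous).continuousAt.eventually
      (e₂.open_target.mem_nhds ?_)
    have := e₂.map_source he₂0
    rw [he₂, hf₂.2.1] at this
    simpa [hf₁.2.1] using this
  obtain ⟨δ, hδ, hball⟩ := Metric.eventually_nhds_iff_ball.1
    ((hφ0.and htarget).and (e₁.open_source.mem_nhds he₁0))
  -- Division by `a ^ N` shrinks the closed disc of radius `n` into the `δ`-disc, where `φ` is the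
  -- explicit branch; then `φ z = d ^ N * φ (z / a ^ N)` gives `F` and `f`.
  obtain ⟨N, hN⟩ := ((tendsto_div_pow_atTop_of_one_lt_norm ha (n : ℂ)).eventually
    (Metric.ball_mem_nhds 0 hδ)).exists
  have haN : a ^ N ≠ 0 := pow_ne_zero N ha0
  have hφN : ∀ k : ℕ, ∀ z, φ (a ^ k * z) = d ^ k * φ z := fun k ↦ by
    induction k with
    | zero => simp
    | succ k ih =>
      intro z
      rw [pow_succ', mul_assoc, hφe, ih, pow_succ', mul_assoc]
  have hscale : ∀ z, HasDerivAt (fun z ↦ f₁ (z / a ^ N)) (deriv f₁ (z / a ^ N) * (1 / a ^ N)) z :=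
    fun z ↦ (hf₁.1 (z / a ^ N)).hasDerivAt.comp z ((hasDerivAt_id z).div_const _)
  refine ⟨fun w ↦ d ^ N * e₂.symm w, fun z ↦ f₁ (z / a ^ N),
    {z | z / a ^ N ∈ Metric.ball (0 : ℂ) δ}, e₂.target, fun z hz ↦ ?_,
    fun z ↦ (hscale z).differentiableAt, fun z hz w hw hzw ↦ ?_, fun z hz ↦ ?_,
    e₂.open_target, he₂s.const_mul _, fun z hz ↦ ⟨(hball _ hz).1.2, ?_⟩⟩
  · rw [mem_closedBall_zero_iff] at hz
    rw [dist_zero_right, norm_div, Complex.norm_natCast] at hN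
    change z / a ^ N ∈ Metric.ball (0 : ℂ) δ
    rw [mem_ball_zero_iff, norm_div]
    exact lt_of_le_of_lt (by gcongr) hN
  · have := e₁.injOn (hball _ hz).2 (hball _ hw).2 (by rw [he₁, he₁]; exact hzw)
    exact (div_left_inj' haN).1 this
  · rw [(hscale z).deriv]
    exact mul_ne_zero (he₁d _ (hball _ hz).2) (one_div_ne_zero haN)
  · change φ z = d ^ N * e₂.symm (ψ (f₁ (z / a ^ N)))
    rw [← (hball _ hz).1.1, ← hφN, mul_div_cancel₀ _ haN]
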